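/- All states are three-qubit states on $\mathbb{C}^2\otimes\mathbb{C}^2\otimes\mathbb{C}^2$ (parties $A,B,C$), not necessarily normalized; a state is separable if it is a combination with non-negative coefficients of pure product states $|x,y,z\rangle\langle x,y,z|$. For $t\in\mathbb{C}\setminus\{0,1\}$ let $$(a_1,a_2,a_3,a_4)=\begin{pmatrix}1&0&1&t\\0&1&1&1\end{pmatrix},\qquad (\phi_1,\phi_2,\phi_3,\phi_4)=\begin{pmatrix}1&1&0&0\\0&0&1&1\\0&0&1&-1\\1&-1&0&0\end{pmatrix},$$ $$\rho(t)=|t^2-t|\,a_1a_1^\dagger\otimes\phi_1\phi_1^\dagger+|t-1|\,a_2a_2^\dagger\otimes\phi_2\phi_2^\dagger+|t|\,a_3a_3^\dagger\otimes\phi_3\phi_3^\dagger+a_4a_4^\dagger\otimes\phi_4\phi_4^\dagger .$$ Each $\rho(t)$ is of type II, that is, it is positive semidefinite, has positive semidefinite partial transposes with respect to each party, is not separable, has rank four, and has zero Lorentz invariant: $\operatorname{Tr}(\rho(t)^T\epsilon_3\,\rho(t)\,\epsilon_3)=0$, where $\epsilon_3=\epsilon\otimes\epsilon\otimes\epsilon$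 and $\epsilon=\begin{pmatrix}0&1\\-1&0\end{pmatrix}$. Two states $\rho,\rho'$ are SLOCC-equivalent if $\rho'=V\rho V^\dagger$ for some $V=V_1\otimes V_2\otimes V_3$ with $V_1,V_2,V_3\in\mathbb{C}^{2\times 2}$ invertible. The characteristic set of $\rho$ is the set of all $s\in\mathbb{C}$ for which there are a decomposition $\rho=\sum_{i=1}^4|\alpha_i\rangle\langle\alpha_i|_A\otimes|\psi_i\rangle\langle\psi_i|_{BC}$ with the $\alpha_i\in\mathbb{C}^2$ pairwise linearly independent and the $\psi_i\in\mathbb{C}^2\otimes\mathbb{C}^2$ linearly independent and entangled (i.e. not product vectors), a permutation $\sigma\in S_4$, an invertible $V\in\mathbb{C}^{2\times2}$ and an invertible diagonal $D\in\mathbb{C}^{4\times4}$ with $$V(\alpha_{\sigma(1)},\alpha_{\sigma(2)},\alpha_{\sigma(3)},\alpha_{\sigma(4)})D=\begin{pmatrix}1&0&1&s\\0&1&1&1\end{pmatrix}.$$ Then for all $t,t'\in\mathbb{C}\setminus\{0,1\}$ the following are equivalent: (1) $\rho(t)$ and $\rho(t')$ are SLOCC-equivalent; (2) $\rho(t)$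 and $\rho(t')$ have the same characteristic set; (3) $t'\in\{t,\ 1/t,\ 1-t,\ 1/(1-t),\ 1-1/t,\ t/(t-1)\}$. -/

import Mathlib

open scoped Kronecker ComplexOrder

namespace ThreeQubit

/-- Vectors of one qubit, `ℂ²`. -/
abbrev Qubit : Type := Fin 2 → ℂ

/-- Vectors of two qubits, `ℂ² ⊗ ℂ²`, in coordinates. -/
abbrev TwoQubit : Type := Fin 2 × Fin 2 → ℂ

/-- Operators on `ℂ² ⊗ ℂ² ⊗ ℂ²` (parties `A`, `B`, `C`, in this order), as matrices. -/
abbrev Op : Type := Matrix (Fin 2 × Fin 2 × Fin 2) (Fin 2 × Fin 2 × Fin 2) ℂ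

/-- The rank-one operator `|v⟩⟨v| = v v†`. -/
def proj {n : Type*} (v : n → ℂ) : Matrix n n ℂ := Matrix.vecMulVec v (star v)

/-- The partial transpose with respect to the first qubit. -/
def ptransposeA (ρ : Op) : Op := fun i j => ρ (j.1, i.2.1, i.2.2) (i.1, j.2.1, j.2.2)

/-- The partial transpose with respect to the second qubit. -/
def ptransposeB (ρ : Op) : Op := fun i j => ρ (i.1, j.2.1, i.2.2) (j.1, i.2.1, j.2.2)

/-- The partial transpose with respect to the third qubit. -/
def ptransposeC (ρ : Op) : Op := fun i j => ρ (i.1, i.2.1, j.2.2) (j.1, j.2.1, i.2.2)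

/-- Positive partial transpose with respect to every party. The partial transposes with respect
to two parties are the transposes of these, so they are positive semidefinite as well. -/
def IsPPT (ρ : Op) : Prop :=
  (ptransposeA ρ).PosSemidef ∧ (ptransposeB ρ).PosSemidef ∧ (ptransposeC ρ).PosSemidef

/-- Full separability of a not necessarily normalized state: `ρ` is a combination of pure
product states with non-negative coefficients. -/
def IsSeparable (ρ : Op) : Prop :=
  ∃ (n : ℕ) (p : Fin n → ℝ) (x y z : Fin n → Qubit), (∀ i, 0 ≤ p i) ∧
    ρ = ∑ i, (p i : ℂ) • (proj (x i) ⊗ₖ (proj (y i) ⊗ₖ proj (z i)))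

/-- A three-qubit rank-four PPT entangled state, not necessarily normalized. -/
structure IsRankFourPPTES (ρ : Op) : Prop where
  posSemidef : ρ.PosSemidef
  ppt : IsPPT ρ
  entangled : ¬ IsSeparable ρ
  rank_eq : ρ.rank = 4

/-- The Levi-Civita symbol `ε`. -/
def leviCivita : Matrix (Fin 2) (Fin 2) ℂ := !![0, 1; -1, 0]

/-- `ε ⊗ ε ⊗ ε`. -/
def leviCivita3 : Op := leviCivita ⊗ₖ (leviCivita ⊗ₖ leviCivita)

/-- The Lorentz invariant `Tr(ρᵀ ε₃ ρ ε₃)`. -/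
def lorentzInvariant (ρ : Op) : ℂ :=
  (ρ.transpose * leviCivita3 * ρ * leviCivita3).trace

/-- Three-qubit rank-four PPT entangled states with zero Lorentz invariant. -/
def IsTypeII (ρ : Op) : Prop := IsRankFourPPTES ρ ∧ lorentzInvariant ρ = 0

/-- `ρ` and `ρ'` are SLOCC-equivalent: `ρ' = V ρ V†` for an invertible product operator
`V = V₁ ⊗ V₂ ⊗ V₃`. -/
def SLOCCEquiv (ρ ρ' : Op) : Prop :=
  ∃ V₁ V₂ V₃ : Matrix (Fin 2) (Fin 2) ℂ, IsUnit V₁ ∧ IsUnit V₂ ∧ IsUnit V₃ ∧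
    ρ' = (V₁ ⊗ₖ (V₂ ⊗ₖ V₃)) * ρ * (V₁ ⊗ₖ (V₂ ⊗ₖ V₃)).conjTranspose

/-- A two-qubit vector is entangled if it is not a product vector. -/
def IsEntangledVec (ψ : TwoQubit) : Prop :=
  ¬ ∃ x y : Qubit, ∀ i j, ψ (i, j) = x i * y j

/-- `ρ = ∑ᵢ |αᵢ⟩⟨αᵢ| ⊗ |ψᵢ⟩⟨ψᵢ|` with respect to the cut `A | BC`, where the four `αᵢ` are
pairwise linearly independent and the four `ψᵢ` are linearly independent and entangled. -/
structure IsBiseparableForm (ρ : Op) (α : Fin 4 → Qubit) (ψ : Fin 4 → TwoQubit) : Prop where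
  eq_sum : ρ = ∑ i, proj (α i) ⊗ₖ proj (ψ i)
  pairwise_indep : ∀ i j, i ≠ j → LinearIndependent ℂ ![α i, α j]
  indep : LinearIndependent ℂ ψ
  entangled : ∀ i, IsEntangledVec (ψ i)

/-- The `2 × 4` matrix with columns `a₁ = (1,0)`, `a₂ = (0,1)`, `a₃ = (1,1)`, `a₄ = (t,1)`. -/
def stdMatrix (t : ℂ) : Matrix (Fin 2) (Fin 4) ℂ :=
  !![1, 0, 1, t;
     0, 1, 1, 1]

/-- The characteristic set of `ρ`: all `s` such that, for some decomposition of `ρ` as above and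
some permutation `σ`, `V (α_{σ(1)}, …, α_{σ(4)}) D` is the matrix `stdMatrix s` for some
invertible `V` and some invertible diagonal matrix `D`. -/
def charSet (ρ : Op) : Set ℂ :=
  {s | ∃ (α : Fin 4 → Qubit) (ψ : Fin 4 → TwoQubit), IsBiseparableForm ρ α ψ ∧
    ∃ (σ : Equiv.Perm (Fin 4)) (V : Matrix (Fin 2) (Fin 2) ℂ) (d : Fin 4 → ℂ),
      IsUnit V ∧ (∀ i, d i ≠ 0) ∧
      V * (Matrix.of fun r j => α (σ j) r) * Matrix.diagonal d = stdMatrix s}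

/-- The vectors `a₁, a₂, a₃, a₄`. -/
def aVec (t : ℂ) (i : Fin 4) : Qubit := fun r => stdMatrix t r i

/-- The (unnormalized) Bell vectors: in the basis `|00⟩, |01⟩, |10⟩, |11⟩` they are
`(1,0,0,1)`, `(1,0,0,-1)`, `(0,1,1,0)`, `(0,1,-1,0)`. -/
def bellVec (i : Fin 4) : TwoQubit := fun p =>
  (![!![1, 0; 0, 1], !![1, 0; 0, -1], !![0, 1; 1, 0], !![0, 1; -1, 0]] :
    Fin 4 → Matrix (Fin 2) (Fin 2) ℂ) i p.1 p.2

/-- The weights `|t² - t|, |t - 1|, |t|, 1`. -/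
noncomputable def weight (t : ℂ) : Fin 4 → ℝ := ![‖t ^ 2 - t‖, ‖t - 1‖, ‖t‖, 1]

/-- The family `ρ(t)`, without normalization. -/
noncomputable def rho (t : ℂ) : Op :=
  ∑ i, (weight t i : ℂ) • (proj (aVec t i) ⊗ₖ proj (bellVec i))

end ThreeQubit

namespace ThreeQubit

/-! The range of a state determines its `A | BC` decompositions. If the `aᵢ` are pairwise
independent and the `φᵢ` independent, the only nonzero product vectors in the span of the `aᵢ ⊗ φᵢ`
are multiples of these (`tensor_mem_span`), and any other decomposition into rank-one terms stays in
that span (`mem_span_of_sum_proj_eq`). With `φᵢ` entangled this excludes separability. It also fixes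
the party `A` vectors up to order and scale, so every element of the characteristic set is a
cross-ratio of the same four points of the projective line, and lies in the six-element orbit of
`t`.

SLOCC equivalence preserves the characteristic set, and `t'` lies in its own set, so (1) ⇒ (2) ⇒
(3). For (3) ⇒ (1), explicit local operators realise `t ↦ 1/t` and `t ↦ 1 - t`, which generate the
orbit.

For type II, the remaining delicate point is PPT in `B` and `C`: the partial transpose is again
Bell-diagonal, with `2 × 2` coefficients that the weights make singular; they are positive by the
triangle inequality for `0, 1, t`. -/

theorem proj_apply {n : Type*} (v : n → ℂ) (i j : n) : proj v i j = v i * star (v j) := rfl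

theorem proj_mulVec {m n : Type*} [Fintype n] (M : Matrix m n ℂ) (v : n → ℂ) :
    M * proj v * M.conjTranspose = proj (M.mulVec v) := by
  rw [proj, proj, Matrix.mul_vecMulVec, Matrix.vecMulVec_mul, Matrix.star_mulVec]

theorem proj_smul {n : Type*} (c : ℂ) (v : n → ℂ) :
    proj (c • v) = ((‖c‖ ^ 2 : ℝ) : ℂ) • proj v := by
  ext i j
  have h : c * star c = ((‖c‖ ^ 2 : ℝ) : ℂ) := by
    rw [Complex.star_def, Complex.mul_conj, Complex.normSq_eq_norm_sq]
  simp only [proj, Matrix.vecMulVec_apply, Matrix.smul_apply, Pi.smul_apply, Pi.star_apply,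
    smul_eq_mul, star_mul', ← h]
  ring

theorem posSemidef_proj {n : Type*} [Fintype n] (v : n → ℂ) : (proj v).PosSemidef :=
  Matrix.posSemidef_vecMulVec_self_star v

/-- The product vector `x ⊗ ψ`. -/
def tensor {m n : Type*} (x : m → ℂ) (ψ : n → ℂ) : m × n → ℂ := fun p => x p.1 * ψ p.2

theorem proj_tensor {m n : Type*} (x : m → ℂ) (ψ : n → ℂ) :
    proj (tensor x ψ) = proj x ⊗ₖ proj ψ := by
  ext i j
  simp only [proj, tensor, Matrix.vecMulVec_apply, Matrix.kroneckerMap_apply, Pi.star_apply,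
    star_mul']
  ring

theorem kronecker_mulVec_tensor {m n : Type*} [Fintype m] [Fintype n]
    (M : Matrix m m ℂ) (N : Matrix n n ℂ) (x : m → ℂ) (ψ : n → ℂ) :
    (M ⊗ₖ N).mulVec (tensor x ψ) = tensor (M.mulVec x) (N.mulVec ψ) := by
  ext p
  simp only [Matrix.mulVec, dotProduct, tensor, Matrix.kroneckerMap_apply, Fintype.sum_prod_type,
    Finset.sum_mul_sum]
  exact Finset.sum_congr rfl fun _ _ => Finset.sum_congr rfl fun _ _ => by ring

/-- The determinant of the pair of vectors `x`, `y`. -/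
def wedge (x y : Qubit) : ℂ := x 0 * y 1 - x 1 * y 0

theorem wedge_smul_left (c : ℂ) (x y : Qubit) : wedge (c • x) y = c * wedge x y := by
  simp [wedge]; ring

theorem wedge_mulVec (V : Matrix (Fin 2) (Fin 2) ℂ) (x y : Qubit) :
    wedge (V.mulVec x) (V.mulVec y) = V.det * wedge x y := by
  simp [wedge, Matrix.mulVec, dotProduct, Fin.sum_univ_two, Matrix.det_fin_two]; ring

theorem exists_smul_of_wedge_eq_zero {x y : Qubit} (hy : y ≠ 0) (h : wedge x y = 0) :
    ∃ c : ℂ, x = c • y := by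
  have hy' : y 0 ≠ 0 ∨ y 1 ≠ 0 := by
    by_contra! h'
    exact hy (by ext i; fin_cases i <;> simp [h'])
  unfold wedge at h
  rcases hy' with h0 | h1
  · refine ⟨x 0 / y 0, ?_⟩
    ext i; fin_cases i
    · simp [h0]
    · simp; field_simp; linear_combination -h
  · refine ⟨x 1 / y 1, ?_⟩
    ext i; fin_cases i
    · simp; field_simp; linear_combination h
    · simp [h1]

theorem linearIndependent_of_wedge_ne_zero {x y : Qubit} (h : wedge x y ≠ 0) :
    LinearIndependent ℂ ![x, y] := by
  rw [LinearIndependent.pair_iff]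
  intro s r hsr
  have h0 := congrFun hsr 0
  have h1 := congrFun hsr 1
  simp only [Pi.add_apply, Pi.smul_apply, smul_eq_mul, Pi.zero_apply] at h0 h1
  unfold wedge at h
  constructor
  · refine (mul_eq_zero.1 ?_).resolve_right h
    linear_combination y 1 * h0 - y 0 * h1
  · refine (mul_eq_zero.1 ?_).resolve_right h
    linear_combination x 0 * h1 - x 1 * h0

theorem wedge_ne_zero_of_linearIndependent {x y : Qubit} (h : LinearIndependent ℂ ![x, y]) :
    wedge x y ≠ 0 := by
  intro hw
  have hy : y ≠ 0 := by simpa using h.ne_zero 1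
  obtain ⟨c, hc⟩ := exists_smul_of_wedge_eq_zero hy hw
  rw [LinearIndependent.pair_iff] at h
  have := (h 1 (-c) (by rw [hc]; simp)).1
  exact one_ne_zero this

/-! ### Product vectors in the range, rank, and a positivity criterion -/

/-- If two families of vectors define the same operator, each member of the first lies in the span
of the second. -/
theorem mem_span_of_sum_proj_eq {n ι κ : Type*} [Fintype n] [Fintype ι] [Fintype κ]
    {u : ι → n → ℂ} {v : κ → n → ℂ} (h : ∑ i, proj (u i) = ∑ j, proj (v j)) (i : ι) :
    u i ∈ Submodule.span ℂ (Set.range v) := by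
  classical
  by_contra hu
  -- A functional killing all `v j` but not `u i`; read as a quadratic form, the hypothesis says
  -- that the sum of the `‖f (u i)‖ ^ 2` is zero.
  obtain ⟨f, hf, hker⟩ := Submodule.exists_le_ker_of_notMem hu
  let x : n → ℂ := fun k => f (Pi.single k 1)
  have hfx (w : n → ℂ) : f w = x ⬝ᵥ w := by
    rw [LinearMap.pi_apply_eq_sum_univ f w, dotProduct]
    refine Finset.sum_congr rfl fun k _ => ?_
    rw [smul_eq_mul, mul_comm]
    congr 2
    ext j
    simp [Pi.single_apply, eq_comm]
  have hq (w : n → ℂ) : x ⬝ᵥ (proj w).mulVec (star x) = ((‖f w‖ ^ 2 : ℝ) : ℂ) := by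
    rw [proj, Matrix.vecMulVec_mulVec, dotProduct_smul, ← hfx, Matrix.star_dotProduct_star,
      ← hfx, ← Complex.normSq_eq_norm_sq, ← Complex.mul_conj]
    rfl
  have hsum := congrArg (fun M : Matrix n n ℂ => x ⬝ᵥ M.mulVec (star x)) h
  simp only [Matrix.sum_mulVec, dotProduct_sum, hq] at hsum
  have hz (j : κ) : f (v j) = 0 := hker (Submodule.subset_span ⟨j, rfl⟩)
  simp only [hz, norm_zero] at hsum
  norm_cast at hsum
  norm_num at hsum
  rw [Finset.sum_eq_zero_iff_of_nonneg (fun _ _ => by positivity)] at hsum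
  exact hf (by simpa using hsum i (Finset.mem_univ i))

/-- The nonzero product vectors in the span of the `a i ⊗ φ i` are the multiples of these. -/
theorem tensor_mem_span {ι n : Type*} [Fintype ι] {a : ι → Qubit} {φ : ι → n → ℂ}
    (ha : ∀ i j, i ≠ j → wedge (a i) (a j) ≠ 0) (ha0 : ∀ i, a i ≠ 0)
    (hφ : LinearIndependent ℂ φ) {x : Qubit} {ψ : n → ℂ} (hx : x ≠ 0) (hψ : ψ ≠ 0)
    (h : tensor x ψ ∈ Submodule.span ℂ (Set.range fun i => tensor (a i) (φ i))) :
    ∃ i, (∃ c : ℂ, c ≠ 0 ∧ x = c • a i) ∧ ∃ c : ℂ, c ≠ 0 ∧ ψ = c • φ i := by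
  obtain ⟨c, hc⟩ := (Submodule.mem_span_range_iff_exists_fun ℂ).1 h
  have key (r : Fin 2) : ∑ i, (c i * a i r) • φ i = x r • ψ := by
    ext k
    have := congrFun hc (r, k)
    simp only [Finset.sum_apply, Pi.smul_apply, tensor, smul_eq_mul] at this ⊢
    rw [← this]
    exact Finset.sum_congr rfl fun _ _ => by ring
  -- Both rows in `key` are multiples of the same `ψ`; eliminating it forces `x` to be parallel to
  -- `a i` whenever `c i ≠ 0`, which can happen for one `i` only.
  have h0 : ∑ i, (c i * wedge x (a i)) • φ i = 0 := by
    have : x 0 • (x 1 • ψ) - x 1 • (x 0 • ψ) = 0 := by rw [smul_comm, sub_self]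
    rw [← key, ← key, Finset.smul_sum, Finset.smul_sum, ← Finset.sum_sub_distrib] at this
    rw [← this]
    refine Finset.sum_congr rfl fun i _ => ?_
    rw [smul_smul, smul_smul, ← sub_smul, wedge]
    congr 1; ring
  have hw := Fintype.linearIndependent_iff.1 hφ _ h0
  obtain ⟨r, hr⟩ : ∃ r, x r ≠ 0 := Function.ne_iff.1 hx
  obtain ⟨i, hi⟩ : ∃ i, c i ≠ 0 := by
    by_contra! hall
    have := key r
    simp only [hall, zero_mul, zero_smul, Finset.sum_const_zero] at this
    exact smul_ne_zero hr hψ this.symm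
  have hwi := (mul_eq_zero.1 (hw i)).resolve_left hi
  obtain ⟨l, hl⟩ := exists_smul_of_wedge_eq_zero (ha0 i) hwi
  have hl0 : l ≠ 0 := by rintro rfl; exact hx (by rw [hl, zero_smul])
  have hj (j : ι) (hji : j ≠ i) : c j = 0 := by
    refine (mul_eq_zero.1 (hw j)).resolve_right ?_
    rw [hl, wedge_smul_left]
    exact mul_ne_zero hl0 (ha i j hji.symm)
  have hk := key r
  rw [Finset.sum_eq_single i (fun j _ hji => by rw [hj j hji, zero_mul, zero_smul])
    (by simp)] at hk
  refine ⟨i, ⟨l, hl0, hl⟩, (x r)⁻¹ * (c i * a i r), ?_, ?_⟩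
  · intro h0
    rw [← inv_smul_smul₀ hr ψ, ← hk, smul_smul, h0, zero_smul] at hψ
    exact hψ rfl
  · rw [← smul_smul, hk, inv_smul_smul₀ hr]

theorem linearIndependent_tensor {ι m n : Type*} [Fintype ι] {a : ι → m → ℂ} {φ : ι → n → ℂ}
    (ha0 : ∀ i, a i ≠ 0) (hφ : LinearIndependent ℂ φ) :
    LinearIndependent ℂ fun i => tensor (a i) (φ i) := by
  rw [Fintype.linearIndependent_iff]
  intro c hc i
  obtain ⟨r, hr⟩ : ∃ r, a i r ≠ 0 := Function.ne_iff.1 (ha0 i)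
  have : ∑ i, (c i * a i r) • φ i = 0 := by
    ext k
    have := congrFun hc (r, k)
    simp only [Finset.sum_apply, Pi.smul_apply, tensor, smul_eq_mul, Pi.zero_apply] at this ⊢
    rw [← this]
    exact Finset.sum_congr rfl fun _ _ => by ring
  exact (mul_eq_zero.1 (Fintype.linearIndependent_iff.1 hφ _ this i)).resolve_right hr

theorem rank_sum_proj {ι n : Type*} [Fintype ι] [Fintype n] {v : ι → n → ℂ}
    (hv : LinearIndependent ℂ v) : (∑ i, proj (v i)).rank = Fintype.card ι := by
  classical
  have : ∑ i, proj (v i) = (Matrix.of v).transpose * (Matrix.of v).transpose.conjTranspose := by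
    ext k l
    simp [Matrix.sum_apply, proj, Matrix.vecMulVec_apply, Matrix.mul_apply]
  rw [this, Matrix.rank_self_mul_conjTranspose, Matrix.rank_transpose]
  exact LinearIndependent.rank_matrix hv

/-- A singular Hermitian matrix with `c > 0` is the rank-one operator `c⁻¹ • proj (b, c)`; if `c =
0`, then `b = 0` too. -/
theorem posSemidef_of_det_eq_zero {M : Matrix (Fin 2) (Fin 2) ℂ} (a c : ℝ) (b : ℂ)
    (ha : 0 ≤ a) (hc : 0 ≤ c) (hb : Complex.normSq b = a * c)
    (hM : M = !![(a : ℂ), b; star b, (c : ℂ)]) : M.PosSemidef := by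
  rcases hc.eq_or_lt with rfl | hc
  · have hb0 : b = 0 := by simpa using hb
    have : M = (a : ℂ) • proj ![1, 0] := by
      rw [hM, hb0]; ext i j; fin_cases i <;> fin_cases j <;> simp [proj_apply]
    rw [this]
    exact (posSemidef_proj _).smul (by exact_mod_cast ha)
  · have : M = ((c⁻¹ : ℝ) : ℂ) • proj ![b, (c : ℂ)] := by
      have hc' : (c : ℂ) ≠ 0 := by exact_mod_cast hc.ne'
      have hb' : b * star b = (a : ℂ) * c := by
        rw [Complex.star_def, Complex.mul_conj, hb]; push_cast; rfl
      rw [hM]; ext i j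
      fin_cases i <;> fin_cases j <;> simp [proj_apply] <;> field_simp
      simpa using hb'.symm
    rw [this]
    exact (posSemidef_proj _).smul (by exact_mod_cast (inv_pos.2 hc).le)


/-! ### Consequences of a biseparable decomposition -/

theorem IsEntangledVec.ne_zero {ψ : TwoQubit} (h : IsEntangledVec ψ) : ψ ≠ 0 := by
  rintro rfl
  exact h ⟨0, 0, by simp⟩

theorem isEntangledVec_of_ne {ψ : TwoQubit} (h : ψ (0, 0) * ψ (1, 1) ≠ ψ (0, 1) * ψ (1, 0)) :
    IsEntangledVec ψ := by
  rintro ⟨x, y, hxy⟩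
  refine h ?_
  simp only [hxy]
  ring

theorem IsEntangledVec.smul {ψ : TwoQubit} (h : IsEntangledVec ψ) {c : ℂ} (hc : c ≠ 0) :
    IsEntangledVec (c • ψ) := by
  rintro ⟨x, y, hxy⟩
  refine h ⟨c⁻¹ • x, y, fun i j => ?_⟩
  rw [Pi.smul_apply, smul_eq_mul, mul_assoc, ← hxy, Pi.smul_apply, smul_eq_mul,
    inv_mul_cancel_left₀ hc]

namespace IsBiseparableForm

variable {ρ : Op} {α : Fin 4 → Qubit} {ψ : Fin 4 → TwoQubit}

theorem eq_sum_proj_tensor (h : IsBiseparableForm ρ α ψ) :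
    ρ = ∑ i, proj (tensor (α i) (ψ i)) := by
  simp only [h.eq_sum, proj_tensor]

theorem left_ne_zero (h : IsBiseparableForm ρ α ψ) (i : Fin 4) : α i ≠ 0 := by
  obtain ⟨j, hj⟩ := exists_ne i
  simpa using (h.pairwise_indep i j hj.symm).ne_zero 0

theorem wedge_ne_zero (h : IsBiseparableForm ρ α ψ) (i j : Fin 4) (hij : i ≠ j) :
    wedge (α i) (α j) ≠ 0 :=
  wedge_ne_zero_of_linearIndependent (h.pairwise_indep i j hij)

theorem posSemidef (h : IsBiseparableForm ρ α ψ) : ρ.PosSemidef := by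
  rw [h.eq_sum_proj_tensor]
  exact Matrix.posSemidef_sum _ fun _ _ => posSemidef_proj _

theorem rank_eq (h : IsBiseparableForm ρ α ψ) : ρ.rank = 4 := by
  rw [h.eq_sum_proj_tensor, rank_sum_proj (linearIndependent_tensor h.left_ne_zero h.indep),
    Fintype.card_fin]

/-- Transposing `proj x` conjugates `x`, so the sum remains one of rank-one projections. -/
theorem posSemidef_ptransposeA (h : IsBiseparableForm ρ α ψ) : (ptransposeA ρ).PosSemidef := by
  have : ptransposeA ρ = ∑ i, proj (tensor (star (α i)) (ψ i)) := by
    ext i j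
    simp only [ptransposeA, h.eq_sum_proj_tensor, Matrix.sum_apply, proj_apply, tensor,
      Pi.star_apply, star_mul', star_star]
    exact Finset.sum_congr rfl fun _ _ => by ring
  rw [this]
  exact Matrix.posSemidef_sum _ fun _ _ => posSemidef_proj _

/-- A nonzero fully product term would lie in the span of the `α j ⊗ ψ j`, making some `ψ j` a
product vector. So all terms vanish, against rank four. -/
theorem not_isSeparable (h : IsBiseparableForm ρ α ψ) : ¬ IsSeparable ρ := by
  rintro ⟨n, p, x, y, z, hp, hρ⟩
  let u : Fin n → Fin 2 × Fin 2 × Fin 2 → ℂ :=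
    fun i => tensor (((√(p i) : ℝ) : ℂ) • x i) (tensor (y i) (z i))
  have hsum : ρ = ∑ i, proj (u i) := by
    rw [hρ]
    refine Finset.sum_congr rfl fun i _ => ?_
    rw [proj_tensor, proj_tensor, proj_smul, Matrix.smul_kronecker, Complex.norm_real,
      Real.norm_eq_abs, sq_abs, Real.sq_sqrt (hp i)]
  have hu (i : Fin n) : u i = 0 := by
    by_contra hne
    have hx : ((√(p i) : ℝ) : ℂ) • x i ≠ 0 := by
      intro h0
      refine hne ?_
      ext k
      simp only [u, h0]
      simp [tensor]
    have hyz : tensor (y i) (z i) ≠ 0 := by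
      intro h0
      refine hne ?_
      ext k
      simp only [u, h0]
      simp [tensor]
    obtain ⟨j, -, c, hc, hψ⟩ := tensor_mem_span h.wedge_ne_zero h.left_ne_zero h.indep hx hyz
      (mem_span_of_sum_proj_eq (hsum.symm.trans h.eq_sum_proj_tensor) i)
    refine (h.entangled j).smul hc ⟨y i, z i, fun k l => ?_⟩
    rw [← hψ]
    rfl
  have h0 : ρ = 0 := by
    rw [hsum]
    refine Finset.sum_eq_zero fun i _ => ?_
    rw [hu i]
    ext k l
    simp [proj_apply]
  have := h.rank_eq
  simp [h0] at this

/-- The vectors of party `A` in a decomposition are unique up to order and scaling. -/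
theorem exists_left_eq_smul {α' : Fin 4 → Qubit} {ψ' : Fin 4 → TwoQubit}
    (h : IsBiseparableForm ρ α ψ) (h' : IsBiseparableForm ρ α' ψ') :
    ∃ (π : Fin 4 → Fin 4) (c : Fin 4 → ℂ), Function.Injective π ∧
      (∀ i, c i ≠ 0) ∧ ∀ i, α' i = c i • α (π i) := by
  have key (i : Fin 4) : ∃ j, ∃ c : ℂ, c ≠ 0 ∧ α' i = c • α j := by
    obtain ⟨j, hj, -⟩ := tensor_mem_span h.wedge_ne_zero h.left_ne_zero h.indep
      (h'.left_ne_zero i) (h'.entangled i).ne_zero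
      (mem_span_of_sum_proj_eq (h'.eq_sum_proj_tensor.symm.trans h.eq_sum_proj_tensor) i)
    exact ⟨j, hj⟩
  choose π c hc hα using key
  refine ⟨π, c, fun i j hij => ?_, hc, hα⟩
  by_contra hne
  refine h'.wedge_ne_zero i j hne ?_
  simp only [hα, hij, wedge, Pi.smul_apply, smul_eq_mul]
  ring

end IsBiseparableForm

/-! ### The decomposition defining `ρ(t)` -/

theorem wedge_aVec_ne_zero {t : ℂ} (h0 : t ≠ 0) (h1 : t ≠ 1) (i j : Fin 4) (hij : i ≠ j) :
    wedge (aVec t i) (aVec t j) ≠ 0 := by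
  have h1' : 1 - t ≠ 0 := sub_ne_zero.2 h1.symm
  have h1'' : t - 1 ≠ 0 := sub_ne_zero.2 h1
  fin_cases i <;> fin_cases j <;> simp_all [wedge, aVec, stdMatrix]

theorem linearIndependent_bellVec : LinearIndependent ℂ bellVec := by
  rw [Fintype.linearIndependent_iff]
  intro g hg
  have e (p : Fin 2 × Fin 2) := congrFun hg p
  have e00 := e (0, 0)
  have e01 := e (0, 1)
  have e10 := e (1, 0)
  have e11 := e (1, 1)
  simp [Fin.sum_univ_four, bellVec] at e00 e01 e10 e11
  intro i
  fin_cases i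
  · simp; linear_combination (e00 + e11) / 2
  · simp; linear_combination (e00 - e11) / 2
  · simp; linear_combination (e01 + e10) / 2
  · simp; linear_combination (e01 - e10) / 2

theorem isEntangledVec_bellVec (i : Fin 4) : IsEntangledVec (bellVec i) := by
  refine isEntangledVec_of_ne ?_
  fin_cases i <;> simp [bellVec]

theorem weight_pos {t : ℂ} (h0 : t ≠ 0) (h1 : t ≠ 1) (i : Fin 4) : 0 < weight t i := by
  have h1' : t - 1 ≠ 0 := sub_ne_zero.2 h1
  have h2 : t ^ 2 - t ≠ 0 := by
    rw [show t ^ 2 - t = t * (t - 1) by ring]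
    exact mul_ne_zero h0 h1'
  fin_cases i <;> simp [weight, h0, h1', h2]

theorem isBiseparableForm_rho {t : ℂ} (h0 : t ≠ 0) (h1 : t ≠ 1) :
    IsBiseparableForm (rho t) (aVec t) fun i => ((√(weight t i) : ℝ) : ℂ) • bellVec i := by
  have hs (i : Fin 4) : ((√(weight t i) : ℝ) : ℂ) ≠ 0 := by
    exact_mod_cast (Real.sqrt_pos.2 (weight_pos h0 h1 i)).ne'
  refine ⟨?_, fun i j hij => linearIndependent_of_wedge_ne_zero (wedge_aVec_ne_zero h0 h1 i j hij),
    ?_, fun i => (isEntangledVec_bellVec i).smul (hs i)⟩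
  · rw [rho]
    refine Finset.sum_congr rfl fun i _ => ?_
    rw [proj_smul, Matrix.kronecker_smul, Complex.norm_real, Real.norm_eq_abs, sq_abs,
      Real.sq_sqrt (weight_pos h0 h1 i).le]
  · exact linearIndependent_bellVec.units_smul fun i => Units.mk0 _ (hs i)

/-! ### Positivity of the partial transposes -/

/-- Twice the coefficient of the Bell projector with index `3 - k` in the partial transpose of
`ρ(t)` with respect to party `B` or `C`. -/
noncomputable def bellCoeff (t : ℂ) (k : Fin 4) : Matrix (Fin 2) (Fin 2) ℂ :=
  (∑ i, (weight t i : ℂ) • proj (aVec t i)) - (2 * weight t k : ℂ) • proj (aVec t k)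

/-- The partial transpose of the `i`-th Bell operator is the identity minus the one with index `3 -
i`, and the identity is half the sum of all four. -/
theorem ptransposeB_sum_bell (A : Fin 4 → Matrix (Fin 2) (Fin 2) ℂ) :
    ptransposeB (∑ i, A i ⊗ₖ proj (bellVec i)) =
      ∑ k, (2⁻¹ : ℂ) • ((∑ i, A i - (2 : ℂ) • A k.rev) ⊗ₖ proj (bellVec k)) := by
  ext ⟨i, k, m⟩ ⟨j, l, n⟩
  simp only [ptransposeB, Fin.sum_univ_four, Matrix.add_apply, Matrix.smul_apply,
    Matrix.kroneckerMap_apply, Matrix.sub_apply, proj_apply, smul_eq_mul]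
  generalize hA : (fun r => A r i j) = B
  simp only [funext_iff] at hA
  simp only [hA]
  fin_cases k <;> fin_cases m <;> fin_cases l <;> fin_cases n <;> simp [bellVec, Fin.rev] <;> ring

theorem ptransposeC_sum_bell (A : Fin 4 → Matrix (Fin 2) (Fin 2) ℂ) :
    ptransposeC (∑ i, A i ⊗ₖ proj (bellVec i)) =
      ∑ k, (2⁻¹ : ℂ) • ((∑ i, A i - (2 : ℂ) • A k.rev) ⊗ₖ proj (bellVec k)) := by
  ext ⟨i, k, m⟩ ⟨j, l, n⟩
  simp only [ptransposeC, Fin.sum_univ_four, Matrix.add_apply, Matrix.smul_apply,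
    Matrix.kroneckerMap_apply, Matrix.sub_apply, proj_apply, smul_eq_mul]
  generalize hA : (fun r => A r i j) = B
  simp only [funext_iff] at hA
  simp only [hA]
  fin_cases k <;> fin_cases m <;> fin_cases l <;> fin_cases n <;> simp [bellVec, Fin.rev] <;> ring

/-- The diagonal entries are nonnegative by the triangle inequalities for side lengths `1, ‖t‖, ‖t -
1‖`; the determinant vanishes by the law of cosines in the triangle `0, 1, t`. -/
theorem posSemidef_bellCoeff (t : ℂ) (k : Fin 4) : (bellCoeff t k).PosSemidef := by
  have tri1 : 0 ≤ 1 + ‖t‖ - ‖t - 1‖ := by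
    have := norm_sub_le t 1
    rw [norm_one] at this
    linarith
  have tri2 : 0 ≤ ‖t‖ + ‖t - 1‖ - 1 := by
    have := norm_sub_le t (t - 1)
    rw [sub_sub_cancel, norm_one] at this
    linarith
  have tri3 : 0 ≤ ‖t - 1‖ + 1 - ‖t‖ := by
    have := norm_add_le (t - 1) 1
    rw [sub_add_cancel, norm_one] at this
    linarith
  have hw : ‖t ^ 2 - t‖ = ‖t‖ * ‖t - 1‖ := by rw [← norm_mul]; ring_nf
  have hp := norm_nonneg t
  have hq := norm_nonneg (t - 1)
  have hp2 : ‖t‖ ^ 2 = t.re ^ 2 + t.im ^ 2 := by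
    rw [← Complex.normSq_eq_norm_sq, Complex.normSq_apply]; ring
  have hq2 : ‖t - 1‖ ^ 2 = (t.re - 1) ^ 2 + t.im ^ 2 := by
    rw [← Complex.normSq_eq_norm_sq, Complex.normSq_apply]; simp; ring
  have htt : t * (starRingEnd ℂ) t = (‖t‖ : ℂ) ^ 2 := by
    rw [Complex.mul_conj, Complex.normSq_eq_norm_sq]; push_cast; rfl
  have expand : bellCoeff t k =
      ((weight t 0 : ℂ) • proj (aVec t 0) + (weight t 1 : ℂ) • proj (aVec t 1) +
        (weight t 2 : ℂ) • proj (aVec t 2) + (weight t 3 : ℂ) • proj (aVec t 3)) -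
        (2 * weight t k : ℂ) • proj (aVec t k) := by
    rw [bellCoeff, Fin.sum_univ_four]
  set p := ‖t‖
  set q := ‖t - 1‖
  fin_cases k
  · refine posSemidef_of_det_eq_zero (p * (1 + p - q)) (p + q + 1) (p + t) (by positivity)
      (by positivity) ?_ ?_
    · rw [Complex.normSq_apply]; simp
      linear_combination p * hq2 - (1 + p) * hp2
    · rw [expand]
      ext i j
      fin_cases i <;> fin_cases j <;>
        simp [weight, proj_apply, aVec, stdMatrix, htt, hw] <;> ring
  · refine posSemidef_of_det_eq_zero (p * (1 + p + q)) (p + 1 - q) (p + t) (by positivity)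
      (by linarith) ?_ ?_
    · rw [Complex.normSq_apply]; simp
      linear_combination p * hq2 - (1 + p) * hp2
    · rw [expand]
      ext i j
      fin_cases i <;> fin_cases j <;>
        simp [weight, proj_apply, aVec, stdMatrix, htt, hw] <;> ring
  · refine posSemidef_of_det_eq_zero (p * (p + q - 1)) (q + 1 - p) (t - p) (by positivity)
      (by linarith) ?_ ?_
    · rw [Complex.normSq_apply]; simp
      linear_combination -p * hq2 - (1 - p) * hp2
    · rw [expand]
      ext i j
      fin_cases i <;> fin_cases j <;>
        simp [weight, proj_apply, aVec, stdMatrix, htt, hw] <;> ring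
  · refine posSemidef_of_det_eq_zero (p * (q + 1 - p)) (p + q - 1) (p - t) (by positivity)
      (by linarith) ?_ ?_
    · rw [Complex.normSq_apply]; simp
      linear_combination -p * hq2 - (1 - p) * hp2
    · rw [expand]
      ext i j
      fin_cases i <;> fin_cases j <;>
        simp [weight, proj_apply, aVec, stdMatrix, htt, hw] <;> ring

theorem posSemidef_sum_bellCoeff (t : ℂ) :
    (∑ k : Fin 4, (2⁻¹ : ℂ) • (bellCoeff t k.rev ⊗ₖ proj (bellVec k))).PosSemidef :=
  Matrix.posSemidef_sum _ fun _ _ =>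
    ((posSemidef_bellCoeff t _).kronecker (posSemidef_proj _)).smul
      (inv_nonneg.2 zero_le_two)

theorem rho_eq (t : ℂ) :
    rho t = ∑ i, ((weight t i : ℂ) • proj (aVec t i)) ⊗ₖ proj (bellVec i) := by
  simp only [rho, Matrix.smul_kronecker]

theorem isPPT_rho {t : ℂ} (h0 : t ≠ 0) (h1 : t ≠ 1) : IsPPT (rho t) := by
  refine ⟨(isBiseparableForm_rho h0 h1).posSemidef_ptransposeA, ?_, ?_⟩
  · rw [rho_eq, ptransposeB_sum_bell]
    simpa only [bellCoeff, mul_smul] using posSemidef_sum_bellCoeff t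
  · rw [rho_eq, ptransposeC_sum_bell]
    simpa only [bellCoeff, mul_smul] using posSemidef_sum_bellCoeff t

/-! ### The Lorentz invariant -/

theorem trace_leviCivita_self (x : Qubit) :
    ((proj x).transpose * leviCivita * proj x * leviCivita).trace = 0 := by
  simp [Matrix.trace, Matrix.mul_apply, Fin.sum_univ_two, proj_apply, leviCivita]
  ring

theorem trace_leviCivita_bellVec {i j : Fin 4} (hij : i ≠ j) :
    ((proj (bellVec i)).transpose * (leviCivita ⊗ₖ leviCivita) * proj (bellVec j) *
      (leviCivita ⊗ₖ leviCivita)).trace = 0 := by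
  fin_cases i <;> fin_cases j <;> first | exact absurd rfl hij | skip
  all_goals
    simp [Matrix.trace, Matrix.mul_apply, Fintype.sum_prod_type, Fin.sum_univ_two, proj_apply,
      leviCivita, bellVec]

/-- In the double sum, the terms `i = j` vanish on `A` since `xᵀ ε x = 0`, the others on `BC` since
distinct Bell vectors are orthogonal for the bilinear form `ε ⊗ ε`. -/
theorem lorentzInvariant_rho (t : ℂ) : lorentzInvariant (rho t) = 0 := by
  simp only [lorentzInvariant, leviCivita3, rho, Matrix.transpose_sum, Matrix.transpose_smul,
    Finset.sum_mul, Finset.mul_sum, Matrix.smul_mul, Matrix.mul_smul, Matrix.trace_sum,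
    Matrix.trace_smul, ← Matrix.kroneckerMap_transpose, ← Matrix.mul_kronecker_mul,
    Matrix.trace_kronecker]
  refine Finset.sum_eq_zero fun i _ => Finset.sum_eq_zero fun j _ => ?_
  rcases eq_or_ne i j with rfl | hij
  · simp [trace_leviCivita_self]
  · simp [trace_leviCivita_bellVec hij.symm]

theorem isTypeII_rho {t : ℂ} (h0 : t ≠ 0) (h1 : t ≠ 1) : IsTypeII (rho t) :=
  have h := isBiseparableForm_rho h0 h1
  ⟨⟨h.posSemidef, isPPT_rho h0 h1, h.not_isSeparable, h.rank_eq⟩, lorentzInvariant_rho t⟩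


/-! ### SLOCC equivalence and its invariance of the characteristic set -/

theorem SLOCCEquiv.refl (ρ : Op) : SLOCCEquiv ρ ρ :=
  ⟨1, 1, 1, isUnit_one, isUnit_one, isUnit_one, by simp⟩

theorem SLOCCEquiv.trans {ρ ρ' ρ'' : Op} (h : SLOCCEquiv ρ ρ') (h' : SLOCCEquiv ρ' ρ'') :
    SLOCCEquiv ρ ρ'' := by
  obtain ⟨V₁, V₂, V₃, h₁, h₂, h₃, rfl⟩ := h
  obtain ⟨W₁, W₂, W₃, k₁, k₂, k₃, rfl⟩ := h'
  refine ⟨W₁ * V₁, W₂ * V₂, W₃ * V₃, k₁.mul h₁, k₂.mul h₂, k₃.mul h₃, ?_⟩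
  rw [Matrix.mul_kronecker_mul, Matrix.mul_kronecker_mul, Matrix.conjTranspose_mul]
  simp only [Matrix.mul_assoc]

theorem SLOCCEquiv.symm {ρ ρ' : Op} (h : SLOCCEquiv ρ ρ') : SLOCCEquiv ρ' ρ := by
  obtain ⟨V₁, V₂, V₃, h₁, h₂, h₃, rfl⟩ := h
  have hV : (V₁⁻¹ ⊗ₖ (V₂⁻¹ ⊗ₖ V₃⁻¹)) * (V₁ ⊗ₖ (V₂ ⊗ₖ V₃)) = 1 := by
    rw [Matrix.isUnit_iff_isUnit_det] at h₁ h₂ h₃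
    rw [← Matrix.mul_kronecker_mul, ← Matrix.mul_kronecker_mul, Matrix.nonsing_inv_mul _ h₁,
      Matrix.nonsing_inv_mul _ h₂, Matrix.nonsing_inv_mul _ h₃, Matrix.one_kronecker_one,
      Matrix.one_kronecker_one]
  refine ⟨V₁⁻¹, V₂⁻¹, V₃⁻¹, ?_, ?_, ?_, ?_⟩
  · rwa [Matrix.isUnit_nonsing_inv_iff]
  · rwa [Matrix.isUnit_nonsing_inv_iff]
  · rwa [Matrix.isUnit_nonsing_inv_iff]
  · rw [Matrix.mul_assoc, Matrix.mul_assoc, ← Matrix.conjTranspose_mul, hV,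
      Matrix.conjTranspose_one, Matrix.mul_one, ← Matrix.mul_assoc, hV, Matrix.one_mul]

theorem kronecker_mulVec_apply (M N : Matrix (Fin 2) (Fin 2) ℂ) (ψ : TwoQubit) (i j : Fin 2) :
    (M ⊗ₖ N).mulVec ψ (i, j) = M i 0 * N j 0 * ψ (0, 0) + M i 0 * N j 1 * ψ (0, 1) +
      (M i 1 * N j 0 * ψ (1, 0) + M i 1 * N j 1 * ψ (1, 1)) := by
  simp [Matrix.mulVec, dotProduct, Fintype.sum_prod_type, Fin.sum_univ_two]

theorem IsEntangledVec.kronecker_mulVec {V W : Matrix (Fin 2) (Fin 2) ℂ} (hV : IsUnit V)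
    (hW : IsUnit W) {ψ : TwoQubit} (h : IsEntangledVec ψ) :
    IsEntangledVec ((V ⊗ₖ W).mulVec ψ) := by
  rintro ⟨x, y, hxy⟩
  rw [Matrix.isUnit_iff_isUnit_det] at hV hW
  have hψ : ψ = tensor (V⁻¹.mulVec x) (W⁻¹.mulVec y) := by
    rw [← kronecker_mulVec_tensor, show tensor x y = (V ⊗ₖ W).mulVec ψ from
      funext fun p => (hxy p.1 p.2).symm, Matrix.mulVec_mulVec, ← Matrix.mul_kronecker_mul,
      Matrix.nonsing_inv_mul _ hV, Matrix.nonsing_inv_mul _ hW, Matrix.one_kronecker_one,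
      Matrix.one_mulVec]
  exact h ⟨_, _, fun i j => congrFun hψ (i, j)⟩

theorem conj_kronecker {m n : Type*} [Fintype m] [Fintype n] (V : Matrix m m ℂ)
    (W : Matrix n n ℂ) (x : m → ℂ) (ψ : n → ℂ) :
    (V ⊗ₖ W) * (proj x ⊗ₖ proj ψ) * (V ⊗ₖ W).conjTranspose =
      proj (V.mulVec x) ⊗ₖ proj (W.mulVec ψ) := by
  rw [← proj_tensor, proj_mulVec, kronecker_mulVec_tensor, proj_tensor]

theorem IsBiseparableForm.conj {ρ : Op} {α : Fin 4 → Qubit} {ψ : Fin 4 → TwoQubit}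
    (h : IsBiseparableForm ρ α ψ) {V₁ V₂ V₃ : Matrix (Fin 2) (Fin 2) ℂ} (h₁ : IsUnit V₁)
    (h₂ : IsUnit V₂) (h₃ : IsUnit V₃) :
    IsBiseparableForm ((V₁ ⊗ₖ (V₂ ⊗ₖ V₃)) * ρ * (V₁ ⊗ₖ (V₂ ⊗ₖ V₃)).conjTranspose)
      (fun i => V₁.mulVec (α i)) (fun i => (V₂ ⊗ₖ V₃).mulVec (ψ i)) where
  eq_sum := by simp only [h.eq_sum, Matrix.mul_sum, Matrix.sum_mul, conj_kronecker]
  pairwise_indep i j hij := by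
    refine linearIndependent_of_wedge_ne_zero ?_
    rw [wedge_mulVec]
    exact mul_ne_zero ((Matrix.isUnit_iff_isUnit_det _).1 h₁).ne_zero (h.wedge_ne_zero i j hij)
  indep := h.indep.map' (V₂ ⊗ₖ V₃).mulVecLin
    (LinearMap.ker_eq_bot.2 (Matrix.mulVec_injective_of_isUnit (Matrix.IsUnit.kronecker h₂ h₃)))
  entangled i := (h.entangled i).kronecker_mulVec h₂ h₃

theorem SLOCCEquiv.charSet_subset {ρ ρ' : Op} (h : SLOCCEquiv ρ ρ') :
    charSet ρ ⊆ charSet ρ' := by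
  obtain ⟨V₁, V₂, V₃, h₁, h₂, h₃, rfl⟩ := h
  rintro s ⟨α, ψ, hαψ, σ, V, d, hV, hd, hs⟩
  refine ⟨_, _, hαψ.conj h₁ h₂ h₃, σ, V * V₁⁻¹, d,
    hV.mul (by rwa [Matrix.isUnit_nonsing_inv_iff]), hd, ?_⟩
  have : (Matrix.of fun r j => V₁.mulVec (α (σ j)) r) =
      V₁ * Matrix.of fun r j => α (σ j) r := by
    ext r j
    simp [Matrix.mulVec, dotProduct, Matrix.mul_apply]
  rw [this, Matrix.mul_assoc V, ← Matrix.mul_assoc V₁⁻¹,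
    Matrix.nonsing_inv_mul _ ((Matrix.isUnit_iff_isUnit_det _).1 h₁), Matrix.one_mul, hs]

theorem SLOCCEquiv.charSet_eq {ρ ρ' : Op} (h : SLOCCEquiv ρ ρ') : charSet ρ = charSet ρ' :=
  h.charSet_subset.antisymm h.symm.charSet_subset

/-! ### The characteristic set and cross-ratios -/

theorem self_mem_charSet_rho {t : ℂ} (h0 : t ≠ 0) (h1 : t ≠ 1) : t ∈ charSet (rho t) := by
  refine ⟨_, _, isBiseparableForm_rho h0 h1, 1, 1, 1, isUnit_one, fun _ => one_ne_zero, ?_⟩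
  rw [Matrix.one_mul, Pi.one_def, Matrix.diagonal_one, Matrix.mul_one]
  rfl

/-- The values of the cross-ratio under the permutations of the four points. -/
def crossRatioOrbit (t : ℂ) : Set ℂ := {t, 1 / t, 1 - t, 1 / (1 - t), 1 - 1 / t, t / (t - 1)}

/-- The hypothesis says, with denominators cleared, that `s` is the cross-ratio of the points in the
order `τ`; it is normalised so that the identity gives `t`. The 24 orders are checked one by one. -/
theorem mem_crossRatioOrbit_of_injective {t s : ℂ} (h0 : t ≠ 0) (h1 : t ≠ 1)
    {τ : Fin 4 → Fin 4} (hτ : Function.Injective τ)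
    (h : wedge (aVec t (τ 1)) (aVec t (τ 3)) * wedge (aVec t (τ 0)) (aVec t (τ 2)) =
      s * (wedge (aVec t (τ 1)) (aVec t (τ 2)) * wedge (aVec t (τ 0)) (aVec t (τ 3)))) :
    s ∈ crossRatioOrbit t := by
  have n01 := hτ.ne (show (0 : Fin 4) ≠ 1 by decide)
  have n02 := hτ.ne (show (0 : Fin 4) ≠ 2 by decide)
  have n03 := hτ.ne (show (0 : Fin 4) ≠ 3 by decide)
  have n12 := hτ.ne (show (1 : Fin 4) ≠ 2 by decide)
  have n13 := hτ.ne (show (1 : Fin 4) ≠ 3 by decide)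
  have n23 := hτ.ne (show (2 : Fin 4) ≠ 3 by decide)
  have h1' : 1 - t ≠ 0 := sub_ne_zero.2 h1.symm
  have h1'' : t - 1 ≠ 0 := sub_ne_zero.2 h1
  have o1 (e : s = t) : s ∈ crossRatioOrbit t := by simp [crossRatioOrbit, e]
  have o2 (e : s * t = 1) : s ∈ crossRatioOrbit t := by
    simp [crossRatioOrbit, eq_inv_of_mul_eq_one_left e]
  have o3 (e : s = 1 - t) : s ∈ crossRatioOrbit t := by simp [crossRatioOrbit, e]
  have o4 (e : s * (1 - t) = 1) : s ∈ crossRatioOrbit t := by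
    simp [crossRatioOrbit, eq_inv_of_mul_eq_one_left e]
  have o5 (e : s * t = t - 1) : s ∈ crossRatioOrbit t := by
    have : s = 1 - 1 / t := by field_simp; exact e
    simp [crossRatioOrbit, this]
  have o6 (e : s * (t - 1) = t) : s ∈ crossRatioOrbit t := by
    have : s = t / (t - 1) := by field_simp; exact e
    simp [crossRatioOrbit, this]
  generalize τ 0 = i at *
  generalize τ 1 = j at *
  generalize τ 2 = k at *
  generalize τ 3 = l at *
  clear hτ
  fin_cases i <;> fin_cases j <;> first | exact absurd rfl n01 | skip
  all_goals fin_cases k <;> first | exact absurd rfl n02 | exact absurd rfl n12 | skip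
  all_goals
    fin_cases l <;>
      first | exact absurd rfl n03 | exact absurd rfl n13 | exact absurd rfl n23 | skip
  all_goals
    simp [wedge, aVec, stdMatrix] at h
    first
    | exact o1 (by linear_combination h) | exact o1 (by linear_combination -h)
    | exact o2 (by linear_combination h) | exact o2 (by linear_combination -h)
    | exact o3 (by linear_combination h) | exact o3 (by linear_combination -h)
    | exact o4 (by linear_combination h) | exact o4 (by linear_combination -h)
    | exact o5 (by linear_combination h) | exact o5 (by linear_combination -h)
    | exact o6 (by linear_combination h) | exact o6 (by linear_combination -h)

theorem charSet_rho_subset {t : ℂ} (h0 : t ≠ 0) (h1 : t ≠ 1) :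
    charSet (rho t) ⊆ crossRatioOrbit t := by
  rintro s ⟨α, ψ, h, σ, V, d, hV, hd, hs⟩
  obtain ⟨π, c, hπ, hc, hα⟩ := (isBiseparableForm_rho h0 h1).exists_left_eq_smul h
  refine mem_crossRatioOrbit_of_injective h0 h1 (hπ.comp σ.injective) ?_
  let e : Fin 4 → ℂ := fun j => c (σ j) * d j
  have he (j : Fin 4) : e j ≠ 0 := mul_ne_zero (hc _) (hd j)
  have hcol (j : Fin 4) : aVec s j = e j • V.mulVec (aVec t (π (σ j))) := by
    ext r
    rw [aVec, ← hs, Matrix.mul_diagonal, Matrix.mul_apply_eq_vecMul]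
    simp only [Matrix.vecMul, dotProduct, Matrix.of_apply, hα, Pi.smul_apply, smul_eq_mul,
      Matrix.mulVec, e, Finset.mul_sum, Finset.sum_mul]
    exact Finset.sum_congr rfl fun _ _ => by ring
  have hw (i j : Fin 4) : wedge (aVec s i) (aVec s j) =
      e i * e j * V.det * wedge (aVec t (π (σ i))) (aVec t (π (σ j))) := by
    rw [mul_assoc, ← wedge_mulVec, hcol, hcol]
    simp only [wedge, Pi.smul_apply, smul_eq_mul]
    ring
  have hs' : wedge (aVec s 1) (aVec s 3) * wedge (aVec s 0) (aVec s 2) =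
      s * (wedge (aVec s 1) (aVec s 2) * wedge (aVec s 0) (aVec s 3)) := by
    simp [wedge, aVec, stdMatrix]
  simp only [hw] at hs'
  -- Each index occurs once on either side of the cross-ratio equation, so this common factor
  -- cancels.
  have hne : e 0 * e 1 * e 2 * e 3 * V.det ^ 2 ≠ 0 := by
    have := ((Matrix.isUnit_iff_isUnit_det _).1 hV).ne_zero
    simp [he, this]
  refine mul_left_cancel₀ hne ?_
  simp only [Function.comp_apply]
  linear_combination hs'

/-! ### Explicit SLOCC equivalences -/

theorem isUnit_of_det_ne_zero {V : Matrix (Fin 2) (Fin 2) ℂ} (h : V.det ≠ 0) : IsUnit V :=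
  (Matrix.isUnit_iff_isUnit_det _).2 h.isUnit

/-- A local operator that permutes the product vectors `aᵢ ⊗ φᵢ` up to scalars that match the
weights transforms `ρ(t)` into `ρ(t')`. -/
theorem sloccEquiv_rho_of_perm {t t' : ℂ} {V₁ V₂ V₃ : Matrix (Fin 2) (Fin 2) ℂ}
    (h₁ : V₁.det ≠ 0) (h₂ : V₂.det ≠ 0) (h₃ : V₃.det ≠ 0) (σ : Equiv.Perm (Fin 4))
    (c e : Fin 4 → ℂ) (ha : ∀ i, V₁.mulVec (aVec t i) = c i • aVec t' (σ i))
    (hb : ∀ i, (V₂ ⊗ₖ V₃).mulVec (bellVec i) = e i • bellVec (σ i))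
    (hw : ∀ i, weight t i * (‖c i‖ ^ 2 * ‖e i‖ ^ 2) = weight t' (σ i)) :
    SLOCCEquiv (rho t) (rho t') := by
  refine ⟨V₁, V₂, V₃, isUnit_of_det_ne_zero h₁, isUnit_of_det_ne_zero h₂,
    isUnit_of_det_ne_zero h₃, ?_⟩
  rw [rho, rho, ← Equiv.sum_comp σ, Matrix.mul_sum, Matrix.sum_mul]
  refine Finset.sum_congr rfl fun i _ => ?_
  rw [Matrix.mul_smul, Matrix.smul_mul, conj_kronecker, ha, hb, proj_smul, proj_smul, Matrix.smul_kronecker, Matrix.kronecker_smul,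
    smul_smul, smul_smul, ← hw i]
  congr 1
  push_cast
  ring

theorem sloccEquiv_rho_inv {t : ℂ} (h0 : t ≠ 0) : SLOCCEquiv (rho t) (rho (1 / t)) := by
  have hp : ‖t‖ ≠ 0 := norm_ne_zero_iff.2 h0
  have hq : ‖(t ^ 2)⁻¹ - t⁻¹‖ = ‖t - 1‖ / ‖t‖ ^ 2 := by
    rw [← norm_pow, ← norm_div, ← norm_neg]; congr 1; field_simp; ring
  have hr : ‖t⁻¹ - 1‖ = ‖t - 1‖ / ‖t‖ := by
    rw [← norm_div, ← norm_neg]; congr 1; field_simp; ring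
  have hw : ‖t ^ 2 - t‖ = ‖t‖ * ‖t - 1‖ := by rw [← norm_mul]; ring_nf
  -- `V₁` exchanges the lines of `a₁` and `a₂`, scaled so that `a₄` maps exactly to the new `a₄`;
  -- the phase gates exchange the first two Bell vectors.
  refine sloccEquiv_rho_of_perm (V₁ := !![0, t⁻¹; t⁻¹, 0]) (V₂ := !![1, 0; 0, Complex.I])
    (V₃ := !![1, 0; 0, Complex.I]) (by simp [Matrix.det_fin_two, h0])
    (by simp [Matrix.det_fin_two]) (by simp [Matrix.det_fin_two]) (Equiv.swap 0 1)
    ![t⁻¹, t⁻¹, t⁻¹, 1] ![1, 1, Complex.I, Complex.I] ?_ ?_ ?_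
  · intro i; ext r
    fin_cases i <;> fin_cases r <;>
      simp [aVec, stdMatrix, Matrix.mulVec, dotProduct, Fin.sum_univ_two, h0,
        Equiv.swap_apply_def]
  · intro i; ext ⟨r, s⟩
    rw [kronecker_mulVec_apply]
    fin_cases i <;> fin_cases r <;> fin_cases s <;>
      simp [bellVec, Equiv.swap_apply_def]
  · intro i
    fin_cases i <;> simp [weight, Equiv.swap_apply_def, hw, hq, hr] <;> field_simp

theorem sloccEquiv_rho_one_sub (t : ℂ) : SLOCCEquiv (rho t) (rho (1 - t)) := by
  have hw : ‖(1 - t) ^ 2 - (1 - t)‖ = ‖t ^ 2 - t‖ := by ring_nf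
  -- `V₁` exchanges `a₂` and `a₃`; Hadamard matrices exchange the middle Bell vectors, and the
  -- factor `1 / 2` makes all scalars `±1`.
  refine sloccEquiv_rho_of_perm (V₁ := !![-1, 1; 0, 1]) (V₂ := !![1, 1; 1, -1])
    (V₃ := !![1 / 2, 1 / 2; 1 / 2, -1 / 2]) (by simp [Matrix.det_fin_two])
    (by norm_num [Matrix.det_fin_two]) (by norm_num [Matrix.det_fin_two]) (Equiv.swap 1 2)
    ![-1, 1, 1, 1] ![1, 1, 1, -1] ?_ ?_ ?_
  · intro i; ext r
    fin_cases i <;> fin_cases r <;>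
      simp [aVec, stdMatrix, Matrix.mulVec, dotProduct, Fin.sum_univ_two,
        Equiv.swap_apply_def] <;> ring
  · intro i; ext ⟨r, s⟩
    rw [kronecker_mulVec_apply]
    fin_cases i <;> fin_cases r <;> fin_cases s <;>
      simp [bellVec, Equiv.swap_apply_def] <;> norm_num
  · intro i
    fin_cases i <;> simp [weight, Equiv.swap_apply_def, hw, norm_sub_rev]

theorem sloccEquiv_rho_of_mem {t t' : ℂ} (h0 : t ≠ 0) (h1 : t ≠ 1)
    (h : t' ∈ crossRatioOrbit t) : SLOCCEquiv (rho t) (rho t') := by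
  have h1' : 1 - t ≠ 0 := sub_ne_zero.2 h1.symm
  have h1'' : t - 1 ≠ 0 := sub_ne_zero.2 h1
  have hinv := sloccEquiv_rho_inv h0
  have hsub := sloccEquiv_rho_one_sub t
  have hinvsub := hinv.trans (sloccEquiv_rho_one_sub (1 / t))
  rcases h with rfl | rfl | rfl | rfl | rfl | rfl
  · exact SLOCCEquiv.refl _
  · exact hinv
  · exact hsub
  · exact hsub.trans (sloccEquiv_rho_inv h1')
  · exact hinvsub
  · have e : t / (t - 1) = 1 / (1 - 1 / t) := by field_simp
    rw [e]
    refine hinvsub.trans (sloccEquiv_rho_inv ?_)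
    intro h
    field_simp at h
    exact h1'' (by simpa using h)

end ThreeQubit

theorem mainTheorem3 :
    (∀ t : ℂ, t ≠ 0 → t ≠ 1 → ThreeQubit.IsTypeII (ThreeQubit.rho t)) ∧
    (∀ t t' : ℂ, t ≠ 0 → t ≠ 1 → t' ≠ 0 → t' ≠ 1 →
      (ThreeQubit.SLOCCEquiv (ThreeQubit.rho t) (ThreeQubit.rho t') ↔
        ThreeQubit.charSet (ThreeQubit.rho t) = ThreeQubit.charSet (ThreeQubit.rho t')) ∧
      (ThreeQubit.SLOCCEquiv (ThreeQubit.rho t) (ThreeQubit.rho t') ↔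
        t' ∈ ({t, 1 / t, 1 - t, 1 / (1 - t), 1 - 1 / t, t / (t - 1)} : Set ℂ))) := by
  refine ⟨fun t h0 h1 => ThreeQubit.isTypeII_rho h0 h1, fun t t' h0 h1 h0' h1' => ?_⟩
  have of_charSet (h : ThreeQubit.charSet (ThreeQubit.rho t) =
      ThreeQubit.charSet (ThreeQubit.rho t')) : t' ∈ ThreeQubit.crossRatioOrbit t :=
    ThreeQubit.charSet_rho_subset h0 h1 (h ▸ ThreeQubit.self_mem_charSet_rho h0' h1')
  exact ⟨⟨fun h => h.charSet_eq, fun h => ThreeQubit.sloccEquiv_rho_of_mem h0 h1 (of_charSet h)⟩,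
    fun h => of_charSet h.charSet_eq, ThreeQubit.sloccEquiv_rho_of_mem h0 h1⟩
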